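/- Let $n\ge 1$, $0<m<1$, and let $V:\mathbb R^n\to[0,\infty)$ be continuous with $V(0)=0$. For a probability density $\rho$ on $\mathbb R^n$ (that is, $0\le\rho\in L^1(\mathbb R^n)$, $\int\rho=1$) put $$\mathcal F[\rho]=\frac1{m-1}\int_{\mathbb R^n}\rho^m\,dx+\int_{\mathbb R^n}V\rho\,dx ,$$ and for a Borel probability measure $\mu\in\mathcal P(\mathbb R^n)$ put $$\widetilde{\mathcal F}[\mu]=\frac1{m-1}\int_{\mathbb R^n}\mu_{ac}^m\,dx+\int_{\mathbb R^n}V\,d\mu ,$$ where $\mu_{ac}$ is the density of the absolutely continuous part of $\mu$; these functionals take values in $[-\infty,+\infty]$ and are set equal to $+\infty$ whenever the potential term is infinite. For $h\ge 0$ let $$\rho_{V+h}(x)=\Big(\tfrac{1-m}{m}\,(V(x)+h)\Big)^{-\frac1{1-m}}\in(0,+\infty],\qquad a_{V+h}=\int_{\mathbb R^n}\rho_{V+h}\,dx\in(0,+\infty].$$ Assume that for some $\varepsilon>0$ $$\inf_{\rho}\Big(\frac1{m-1}\int_{\mathbb R^n}\rho^m\,dx+(1-\varepsilon)\int_{\mathbb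 R^n}V\rho\,dx\Big)>-\infty ,$$ the infimum being over all probability densities $\rho$ (with the same convention: the value is $+\infty$ if $\int V\rho=\infty$). Then: 1. There are constants $C,K>0$ such that, for every probability density $\rho$, $$\int_{\mathbb R^n}\rho^m\,dx+\int_{\mathbb R^n}V\rho\,dx\le C\,(K+\mathcal F[\rho]).$$ If, furthermore, $V$ is radially symmetric and non-decreasing in $|x|$, then: 2. There exists $\mu_\infty\in\mathcal P(\mathbb R^n)$ such that $$\widetilde{\mathcal F}[\mu_\infty]=\inf_{\mu\in\mathcal P(\mathbb R^n)}\widetilde{\mathcal F}[\mu]=\inf_{\rho}\mathcal F[\rho],$$ the last infimum being over all probability densities $\rho$. 3. Either $a_{V+h}=1$ for some $h\ge0$, or $a_V<1$, and every minimiser $\mu_\infty$ of $\widetilde{\mathcal F}$ in $\mathcal P(\mathbb R^n)$ is given by $$\mu_\infty=\begin{cases}\rho_{V+h}\,dx & \text{if } h\ge 0 \text{ and } a_{V+h}=1,\\ (1-a_V)\,\delta_0+\rho_V\,dx & \text{if } a_V<1.\end{cases}$$ -/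

import Mathlib

open MeasureTheory
open scoped ENNReal

/-- A probability density on `ℝⁿ`: a non-negative integrable function of total mass one. -/
structure IsProbDensity {n : ℕ} (ρ : EuclideanSpace ℝ (Fin n) → ℝ) : Prop where
  nonneg : ∀ x, 0 ≤ ρ x
  integrable : Integrable ρ volume
  mass_one : ∫ x, ρ x = 1

/-- The extended real number `I / (m - 1) + c P`, where `I ∈ [0, ∞]` stands for `∫ ρ ^ m`
and `P ∈ [0, ∞]` for the potential energy `∫ V ρ`. The value is `+∞` whenever `P = ∞`; in
particular configurations with `P = I = ∞`, for which the expression is undetermined, are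
irrelevant in infima. If `P < ∞ = I` and `m < 1` the value is `-∞`. -/
noncomputable def energyValue (m c : ℝ) (I P : ℝ≥0∞) : EReal :=
  open Classical in
  if P = ∞ then ⊤
  else ((1 / (m - 1) : ℝ) : EReal) * (I : EReal) + ((c * P.toReal : ℝ) : EReal)

/-- `∫ ρ ^ m`, with values in `[0, ∞]`, for a non-negative function `ρ`. -/
noncomputable def powerIntegral {n : ℕ} (m : ℝ) (ρ : EuclideanSpace ℝ (Fin n) → ℝ) : ℝ≥0∞ :=
  ∫⁻ x, ENNReal.ofReal (ρ x ^ m)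

/-- `∫ V ρ`, with values in `[0, ∞]`, for non-negative functions `V` and `ρ`. -/
noncomputable def potentialIntegral {n : ℕ} (V ρ : EuclideanSpace ℝ (Fin n) → ℝ) : ℝ≥0∞ :=
  ∫⁻ x, ENNReal.ofReal (V x * ρ x)

/-- `∫ ρ ^ m / (m - 1) + c ∫ V ρ`, the free energy in which the potential `V` is multiplied
by the constant `c`. -/
noncomputable def scaledFreeEnergy {n : ℕ} (m c : ℝ) (V ρ : EuclideanSpace ℝ (Fin n) → ℝ) :
    EReal :=
  energyValue m c (powerIntegral m ρ) (potentialIntegral V ρ)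

/-- The free energy `F[ρ] = ∫ ρ ^ m / (m - 1) + ∫ V ρ`. -/
noncomputable def freeEnergy {n : ℕ} (m : ℝ) (V ρ : EuclideanSpace ℝ (Fin n) → ℝ) : EReal :=
  scaledFreeEnergy m 1 V ρ

/-- The relaxed free energy `∫ (μ_ac) ^ m / (m - 1) + ∫ V dμ` of a measure `μ`, where `μ_ac` is
the density of the absolutely continuous part of `μ` with respect to Lebesgue measure. -/
noncomputable def relaxedFreeEnergy {n : ℕ} (m : ℝ) (V : EuclideanSpace ℝ (Fin n) → ℝ)
    (μ : Measure (EuclideanSpace ℝ (Fin n))) : EReal :=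
  energyValue m 1 (∫⁻ x, μ.rnDeriv volume x ^ m) (∫⁻ x, ENNReal.ofReal (V x) ∂μ)

/-- The steady state `ρ_{V+h}(x) = ((1 - m) / m * (V x + h)) ^ (-1 / (1 - m))`, with values in
`[0, ∞]`; it is `+∞` at the points where `V + h` vanishes. -/
noncomputable def steadyState {n : ℕ} (m : ℝ) (V : EuclideanSpace ℝ (Fin n) → ℝ) (h : ℝ)
    (x : EuclideanSpace ℝ (Fin n)) : ℝ≥0∞ :=
  ENNReal.ofReal ((1 - m) / m * (V x + h)) ^ (-(1 / (1 - m)))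

/-- The mass `a_{V+h} = ∫ ρ_{V+h}`, with values in `[0, ∞]`. -/
noncomputable def steadyMass {n : ℕ} (m : ℝ) (V : EuclideanSpace ℝ (Fin n) → ℝ) (h : ℝ) : ℝ≥0∞ :=
  ∫⁻ x, steadyState m V h x

/-! The function t ↦ t^m is strictly concave and ρ_{V+h} satisfies m ρ^(m-1) = (1-m)(V+h), so its
tangent at the height ρ_{V+h}(x) gives the pointwise inequality t^m ≤ (1-m)((V(x)+h) t +
ρ_{V+h}(x)^m), with equality only at t = ρ_{V+h}(x) (`rpow_le_young`, `eq_steadyState_of_young_eq`).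
Integrated against a unit mass it bounds both energies below by -D, where D = h + ∫ ρ_{V+h}^m. For a
measure, the singular part adds ∫ (V+h) dμ_s ≥ 0 to the slack.

The bound is attained by ρ_{V+h} dx + (1-a_{V+h}) δ_0 as soon as a_{V+h} ≤ 1 and h (1-a_{V+h}) = 0:
the atom costs nothing because V(0) = 0. Spreading the missing mass over a small ball around 0 shows
that densities have the same infimum. Equality in the tangent inequality identifies the absolutely
continuous part of a minimiser and forces ∫ (V+h) dμ_s = 0. Radial monotonicity then confines μ_s to
the origin.

The coercivity hypothesis makes D finite and an admissible h available: F is bounded below, and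
testing this bound with truncated, rescaled steady states (`truncated_steadyState_bound`) bounds
their masses and potential energies uniformly in the truncation. -/

/-! ### Arithmetic of extended-real energies -/

theorem energyValue_of_ne_top {m c : ℝ} {I P : ℝ≥0∞} (hI : I ≠ ∞) (hP : P ≠ ∞) :
    energyValue m c I P = ((1 / (m - 1) * I.toReal + c * P.toReal : ℝ) : EReal) := by
  lift I to NNReal using hI
  rw [energyValue, if_neg hP, EReal.coe_add, EReal.coe_mul]
  rfl

theorem energyValue_top_right (m c : ℝ) (I : ℝ≥0∞) : energyValue m c I ∞ = ⊤ := by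
  rw [energyValue, if_pos rfl]

theorem energyValue_top_left {m c : ℝ} {P : ℝ≥0∞} (hm1 : m < 1) (hP : P ≠ ∞) :
    energyValue m c ∞ P = ⊥ := by
  rw [energyValue, if_neg hP, EReal.coe_ennreal_top, EReal.coe_mul_top_of_neg, EReal.bot_add]
  exact one_div_neg.mpr (by linarith)

theorem energyValue_mono {m : ℝ} (hm1 : m < 1) {I I' P P' : ℝ≥0∞} (hI : I' ≤ I) (hP : P ≤ P') :
    energyValue m 1 I P ≤ energyValue m 1 I' P' := by
  by_cases hP' : P' = ∞
  · rw [hP', energyValue_top_right]; exact le_top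
  have hPt : P ≠ ∞ := ne_top_of_le_ne_top hP' hP
  by_cases hIt : I = ∞
  · rw [hIt, energyValue_top_left hm1 hPt]; exact bot_le
  rw [energyValue_of_ne_top hIt hPt, energyValue_of_ne_top (ne_top_of_le_ne_top hIt hI) hP']
  have h1 := ENNReal.toReal_mono hIt hI
  have h2 := ENNReal.toReal_mono hP' hP
  have h3 : 1 / (m - 1) ≤ 0 := (one_div_neg.mpr (by linarith)).le
  have h4 := mul_le_mul_of_nonpos_left h1 h3
  exact_mod_cast (by linarith)

theorem toReal_ofReal_mul_add {m : ℝ} (hm1 : m < 1) {P : ℝ≥0∞} (hP : P ≠ ∞) (D : NNReal) :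
    (ENNReal.ofReal (1 - m) * (P + D)).toReal = (1 - m) * (P.toReal + D) := by
  rw [ENNReal.toReal_mul, ENNReal.toReal_ofReal (by linarith), ENNReal.toReal_add hP (by simp)]
  simp

/-- Moves energy bounds into `ℝ≥0∞`, where the tangent inequality can be integrated without
integrability side conditions. -/
theorem neg_le_energyValue_iff {m : ℝ} (hm1 : m < 1) {I P : ℝ≥0∞} (D : NNReal) :
    ((-(D : ℝ) : ℝ) : EReal) ≤ energyValue m 1 I P ↔ I ≤ ENNReal.ofReal (1 - m) * (P + D) := by
  have hd : (0 : ℝ) < 1 - m := by linarith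
  by_cases hP : P = ∞
  · rw [hP, energyValue_top_right, top_add, ENNReal.mul_top (by simpa using hm1)]
    simp
  have hR : ENNReal.ofReal (1 - m) * (P + D) ≠ ∞ := by finiteness
  by_cases hI : I = ∞
  · rw [hI, energyValue_top_left hm1 hP]
    simp only [le_bot_iff, EReal.coe_ne_bot, top_le_iff, hR]
  rw [energyValue_of_ne_top hI hP, EReal.coe_le_coe_iff, ← ENNReal.toReal_le_toReal hI hR,
    toReal_ofReal_mul_add hm1 hP]
  have h1 : 1 / (m - 1) * I.toReal = -(I.toReal / (1 - m)) := by
    rw [← neg_sub, one_div, inv_neg]; ring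
  rw [h1, ← div_le_iff₀' hd]
  constructor <;> intro <;> linarith

theorem energyValue_eq_neg_iff {m : ℝ} (hm1 : m < 1) {I P : ℝ≥0∞} (D : NNReal) :
    energyValue m 1 I P = ((-(D : ℝ) : ℝ) : EReal) ↔
      P ≠ ∞ ∧ I = ENNReal.ofReal (1 - m) * (P + D) := by
  have hd : (0 : ℝ) < 1 - m := by linarith
  by_cases hP : P = ∞
  · rw [hP, energyValue_top_right]
    simp [-EReal.coe_neg]
  have hR : ENNReal.ofReal (1 - m) * (P + D) ≠ ∞ := by finiteness
  by_cases hI : I = ∞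
  · rw [hI, energyValue_top_left hm1 hP]
    simp [-EReal.coe_neg, hR.symm]
  rw [energyValue_of_ne_top hI hP, EReal.coe_eq_coe_iff, ← ENNReal.toReal_eq_toReal_iff' hI hR,
    toReal_ofReal_mul_add hm1 hP]
  have h1 : 1 / (m - 1) * I.toReal = -(I.toReal / (1 - m)) := by
    rw [← neg_sub, one_div, inv_neg]; ring
  rw [h1, mul_comm (1 - m), ← div_eq_iff hd.ne']
  simp only [ne_eq, hP, not_false_eq_true, true_and]
  constructor <;> intro <;> linarith

/-! ### Control of both energy terms -/

/-- Keeping a fraction ε of the potential in reserve gives F ≥ εP - L. Hence P is controlled by F,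
and then so is I, since I/(1-m) = P - F. -/
theorem exists_control_of_scaledFreeEnergy_bounded_below {n : ℕ} {m : ℝ} (hm0 : 0 < m) (hm1 : m < 1)
    {V : EuclideanSpace ℝ (Fin n) → ℝ}
    (hbelow : ∃ ε : ℝ, 0 < ε ∧
      ⊥ < ⨅ ρ : {ρ : EuclideanSpace ℝ (Fin n) → ℝ // IsProbDensity ρ},
        scaledFreeEnergy m (1 - ε) V ρ.1) :
    ∃ C K : ℝ, 0 < C ∧ 0 < K ∧
      ∀ ρ : EuclideanSpace ℝ (Fin n) → ℝ, IsProbDensity ρ →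
        ((powerIntegral m ρ + potentialIntegral V ρ : ℝ≥0∞) : EReal) ≤
          (C : EReal) * ((K : EReal) + freeEnergy m V ρ) := by
  obtain ⟨ε, hε, hb⟩ := hbelow
  obtain ⟨L', -, hL'⟩ := EReal.lt_iff_exists_real_btwn.mp hb
  obtain ⟨L, hL, hL0⟩ : ∃ L : ℝ, -L ≤ L' ∧ 0 ≤ L := ⟨|L'|, neg_abs_le L', abs_nonneg _⟩
  -- With w = I/(1-m) ≥ I, one has I + P ≤ 2P - F ≤ (2/ε)(L + F) + L, using F ≥ -L. The summand 1
  -- only makes K positive.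
  refine ⟨2 / ε, L + L * ε / 2 + 1, by positivity, by positivity, fun ρ hρ => ?_⟩
  have h1 : (L' : EReal) ≤ scaledFreeEnergy m (1 - ε) V ρ := hL'.le.trans (iInf_le (fun ρ : {ρ : EuclideanSpace ℝ (Fin n) → ℝ // IsProbDensity ρ} =>
      scaledFreeEnergy m (1 - ε) V ρ.1) ⟨ρ, hρ⟩)
  rw [freeEnergy]
  rw [scaledFreeEnergy] at h1 ⊢
  generalize powerIntegral m ρ = I at *
  generalize potentialIntegral V ρ = P at *
  by_cases hP : P = ∞
  · rw [hP, energyValue_top_right, EReal.coe_add_top, EReal.coe_mul_top_of_pos (by positivity)]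
    exact le_top
  by_cases hI : I = ∞
  · rw [hI, energyValue_top_left hm1 hP] at h1
    simp at h1
  rw [energyValue_of_ne_top hI hP] at h1 ⊢
  rw [EReal.coe_le_coe_iff] at h1
  lift I to NNReal using hI
  lift P to NNReal using hP
  simp only [ENNReal.coe_toReal] at h1 ⊢
  have h2 : 1 / (m - 1) * (I : ℝ) = -(I / (1 - m)) := by
    rw [← neg_sub, one_div, inv_neg]; ring
  rw [h2] at h1 ⊢
  have h5 : ((I : ℝ) + P) ≤ 2 / ε * (L + L * ε / 2 + 1 + (-(I / (1 - m)) + 1 * P)) := by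
    have hd : (0 : ℝ) < 1 - m := by linarith
    obtain ⟨w, hw⟩ : ∃ w : ℝ, w = I / (1 - m) := ⟨_, rfl⟩
    have hI0 : (0 : ℝ) ≤ I := I.2
    have hIw : (I : ℝ) ≤ w := by
      rw [hw, le_div_iff₀ hd]; nlinarith
    rw [← hw] at h1 ⊢
    have hεP : 0 ≤ ε * (P : ℝ) := by positivity
    have e1 : ε * (P : ℝ) ≤ L + (-w + 1 * P) := by linarith
    have e2 : 2 * (P : ℝ) ≤ 2 / ε * (L + (-w + 1 * P)) := by
      rw [div_mul_eq_mul_div, le_div_iff₀ hε]; linarith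
    have e3 : 2 / ε * (L + L * ε / 2 + 1 + (-w + 1 * P)) =
        2 / ε * (L + (-w + 1 * P)) + L + 2 / ε := by field_simp; ring
    have e4 : 0 < 2 / ε := by positivity
    linarith
  have h6 : (((I : ℝ≥0∞) + (P : ℝ≥0∞) : ℝ≥0∞) : EReal) = (((I : ℝ) + P : ℝ) : EReal) := rfl
  rw [h6]
  exact_mod_cast h5

/-! ### Lower bound of the energy and test densities -/

section
variable {n : ℕ}

/-- The left side of the control estimate is non-negative, so F ≥ -K. -/
theorem exists_powerIntegral_le {m : ℝ} (hm1 : m < 1)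
    {V : EuclideanSpace ℝ (Fin n) → ℝ}
    (hC : ∃ C K : ℝ, 0 < C ∧ 0 < K ∧
      ∀ ρ : EuclideanSpace ℝ (Fin n) → ℝ, IsProbDensity ρ →
        ((powerIntegral m ρ + potentialIntegral V ρ : ℝ≥0∞) : EReal) ≤
          (C : EReal) * ((K : EReal) + freeEnergy m V ρ)) :
    ∃ K : NNReal, ∀ ρ : EuclideanSpace ℝ (Fin n) → ℝ, IsProbDensity ρ →
      powerIntegral m ρ ≤ ENNReal.ofReal (1 - m) * (potentialIntegral V ρ + K) := by
  obtain ⟨C, K, hC, hK, h⟩ := hC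
  refine ⟨K.toNNReal, fun ρ hρ => ?_⟩
  rw [← neg_le_energyValue_iff hm1, Real.coe_toNNReal K hK.le]
  have h1 : (0 : EReal) ≤ C * (K + freeEnergy m V ρ) :=
    (EReal.coe_ennreal_nonneg _).trans (h ρ hρ)
  change ((-K : ℝ) : EReal) ≤ freeEnergy m V ρ
  generalize freeEnergy m V ρ = F at h1 ⊢
  induction F with
  | bot => rw [EReal.add_bot, EReal.coe_mul_bot_of_pos hC] at h1; simp at h1
  | top => exact le_top
  | coe x =>
    have h2 : 0 ≤ C * (K + x) := by
      rw [← EReal.coe_add, ← EReal.coe_mul] at h1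
      exact EReal.coe_nonneg.mp h1
    have h3 := nonneg_of_mul_nonneg_right h2 hC
    exact EReal.coe_le_coe_iff.mpr (by linarith)

theorem isProbDensity_toReal {g : EuclideanSpace ℝ (Fin n) → ℝ≥0∞} (hg : Measurable g)
    (h1 : ∫⁻ x, g x = 1) : IsProbDensity fun x => (g x).toReal where
  nonneg _ := ENNReal.toReal_nonneg
  integrable := integrable_toReal_of_lintegral_ne_top hg.aemeasurable (by simp [h1])
  mass_one := by
    rw [integral_toReal hg.aemeasurable (ae_lt_top hg (by simp [h1])), h1, ENNReal.toReal_one]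

theorem powerIntegral_toReal {m : ℝ} (hm0 : 0 < m) {g : EuclideanSpace ℝ (Fin n) → ℝ≥0∞}
    (hg : Measurable g) (h1 : ∫⁻ x, g x ≠ ∞) :
    powerIntegral m (fun x => (g x).toReal) = ∫⁻ x, g x ^ m := by
  refine lintegral_congr_ae ?_
  filter_upwards [ae_lt_top hg h1] with x hx
  rw [← ENNReal.ofReal_rpow_of_nonneg ENNReal.toReal_nonneg hm0.le, ENNReal.ofReal_toReal hx.ne]

theorem potentialIntegral_toReal {V : EuclideanSpace ℝ (Fin n) → ℝ} (hV : ∀ x, 0 ≤ V x)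
    {g : EuclideanSpace ℝ (Fin n) → ℝ≥0∞} (hg : Measurable g) (h1 : ∫⁻ x, g x ≠ ∞) :
    potentialIntegral V (fun x => (g x).toReal) = ∫⁻ x, ENNReal.ofReal (V x) * g x := by
  refine lintegral_congr_ae ?_
  filter_upwards [ae_lt_top hg h1] with x hx
  rw [ENNReal.ofReal_mul (hV x), ENNReal.ofReal_toReal hx.ne]

/-- A sub-probability density can be completed to a probability density, by a multiple of the
uniform density of a small ball. -/
theorem exists_isProbDensity_completion {m : ℝ} (hm0 : 0 < m) {V : EuclideanSpace ℝ (Fin n) → ℝ}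
    (hVc : Continuous V) (hV : ∀ x, 0 ≤ V x) (hV0 : V 0 = 0)
    {f : EuclideanSpace ℝ (Fin n) → ℝ≥0∞} (hf : Measurable f) (hf1 : ∫⁻ x, f x ≤ 1)
    {δ : ℝ} (hδ : 0 < δ) :
    ∃ ρ, IsProbDensity ρ ∧ ∫⁻ x, f x ^ m ≤ powerIntegral m ρ ∧
      potentialIntegral V ρ ≤ (∫⁻ x, ENNReal.ofReal (V x) * f x) + ENNReal.ofReal δ := by
  obtain ⟨r, hr, hrV⟩ : ∃ r > 0, ∀ x ∈ Metric.ball (0 : EuclideanSpace ℝ (Fin n)) r, V x < δ := by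
    have : ∀ᶠ x in nhds (0 : EuclideanSpace ℝ (Fin n)), V x < δ :=
      hVc.continuousAt.eventually_lt continuousAt_const (by rwa [hV0])
    exact Metric.eventually_nhds_iff_ball.mp this
  obtain ⟨B, hB⟩ : ∃ B, B = Metric.ball (0 : EuclideanSpace ℝ (Fin n)) r := ⟨_, rfl⟩
  rw [← hB] at hrV
  have hBm : MeasurableSet B := hB ▸ measurableSet_ball
  have hB0 : volume B ≠ 0 := by rw [hB]; exact (Metric.measure_ball_pos volume _ hr).ne'
  have hBt : volume B ≠ ∞ := by rw [hB]; exact measure_ball_lt_top.ne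
  obtain ⟨c, hc⟩ : ∃ c, c = (1 - ∫⁻ x, f x) / volume B := ⟨_, rfl⟩
  have hcB : c * volume B = 1 - ∫⁻ x, f x := by rw [hc, ENNReal.div_mul_cancel hB0 hBt]
  obtain ⟨g, hg⟩ : ∃ g : EuclideanSpace ℝ (Fin n) → ℝ≥0∞,
      g = fun x => f x + B.indicator (fun _ => c) x := ⟨_, rfl⟩
  have hgm : Measurable g := hg ▸ hf.add (measurable_const.indicator hBm)
  have hg1 : ∫⁻ x, g x = 1 := by
    rw [hg, lintegral_add_left hf, lintegral_indicator_const hBm, hcB,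
      add_tsub_cancel_of_le hf1]
  have hgt : ∫⁻ x, g x ≠ ∞ := by simp [hg1]
  refine ⟨_, isProbDensity_toReal hgm hg1, ?_, ?_⟩
  · rw [powerIntegral_toReal hm0 hgm hgt]
    gcongr with x
    rw [hg]
    exact le_self_add
  · rw [potentialIntegral_toReal hV hgm hgt]
    have hVm : Measurable fun x => ENNReal.ofReal (V x) := hVc.measurable.ennreal_ofReal
    calc ∫⁻ x, ENNReal.ofReal (V x) * g x
        ≤ ∫⁻ x, (ENNReal.ofReal (V x) * f x + B.indicator (fun _ => ENNReal.ofReal δ * c) x) := by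
          refine lintegral_mono fun x => ?_
          rw [hg]
          simp only [mul_add]
          gcongr
          by_cases hx : x ∈ B
          · simp only [hx, Set.indicator_of_mem]
            gcongr
            exact (hrV x hx).le
          · simp [hx]
      _ = (∫⁻ x, ENNReal.ofReal (V x) * f x) + ENNReal.ofReal δ * (1 - ∫⁻ x, f x) := by
          rw [lintegral_add_left (f := fun x => ENNReal.ofReal (V x) * f x) (hVm.mul hf),
            lintegral_indicator_const hBm, mul_assoc, hcB]
      _ ≤ _ := by
          gcongr
          exact mul_le_of_le_one_right' tsub_le_self

end

/-! ### Steady states and the pointwise tangent inequality -/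

section
variable {n : ℕ} {m : ℝ} {V : EuclideanSpace ℝ (Fin n) → ℝ} {h : ℝ}

theorem measurable_steadyState (m : ℝ) (hVc : Continuous V) (h : ℝ) :
    Measurable (steadyState m V h) :=
  (((hVc.measurable.add_const h).const_mul _).ennreal_ofReal).pow_const _

theorem ofReal_ratio_pos (hm0 : 0 < m) (hm1 : m < 1) {w : ℝ} (hw : 0 < w) :
    0 < (1 - m) / m * w := by
  have : 0 < 1 - m := by linarith
  positivity

theorem steadyState_eq_top (hm1 : m < 1) {x : EuclideanSpace ℝ (Fin n)}
    (hx : V x + h = 0) : steadyState m V h x = ∞ := by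
  rw [steadyState, hx, mul_zero, ENNReal.ofReal_zero, ENNReal.zero_rpow_of_neg]
  rw [neg_lt_zero]
  exact one_div_pos.mpr (by linarith)

/-- The Euler–Lagrange relation `(1 - m) (V + h) ρ = m ρ ^ m`. -/
theorem steadyState_rpow (hm0 : 0 < m) (hm1 : m < 1) {x : EuclideanSpace ℝ (Fin n)}
    (hx : 0 < V x + h) : steadyState m V h x ^ m =
      ENNReal.ofReal ((1 - m) / m) * (ENNReal.ofReal (V x + h) * steadyState m V h x) := by
  have hd : 0 < 1 - m := by linarith
  have ht := ofReal_ratio_pos hm0 hm1 hx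
  rw [← mul_assoc, ← ENNReal.ofReal_mul (by positivity), steadyState, ← ENNReal.rpow_mul]
  conv_rhs => rw [← ENNReal.rpow_one (ENNReal.ofReal ((1 - m) / m * (V x + h)))]
  rw [← ENNReal.rpow_mul, ← ENNReal.rpow_add _ _ (by simpa using ht) (by simp)]
  congr 1
  field_simp
  ring

theorem steadyState_antitone (hm0 : 0 < m) (hm1 : m < 1) (x : EuclideanSpace ℝ (Fin n)) {h h' : ℝ}
    (hh : h ≤ h') : steadyState m V h' x ≤ steadyState m V h x := by
  rw [steadyState, steadyState]
  have : 0 < 1 - m := by linarith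
  rw [ENNReal.rpow_neg, ENNReal.rpow_neg]
  gcongr

/-- Tangent to t^m at s, reduced by homogeneity to Bernoulli's inequality for t/s - 1, which is
strict away from t = s. -/
theorem bernoulli_young (hm0 : 0 < m) (hm1 : m < 1) {s t : ℝ} (hs : 0 < s) (ht : 0 ≤ t) :
    t ^ m ≤ m * s ^ (m - 1) * t + (1 - m) * s ^ m ∧
      (t ^ m = m * s ^ (m - 1) * t + (1 - m) * s ^ m → t = s) := by
  have e1 : m * s ^ (m - 1) * t + (1 - m) * s ^ m = s ^ m * (1 + m * (t / s - 1)) := by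
    rw [Real.rpow_sub_one hs.ne']
    field_simp
    ring
  have e2 : t ^ m = s ^ m * (1 + (t / s - 1)) ^ m := by
    rw [add_sub_cancel, Real.div_rpow ht hs.le]
    field_simp
  have hsm : 0 < s ^ m := by positivity
  have hts : -1 ≤ t / s - 1 := by
    have : 0 ≤ t / s := by positivity
    linarith
  rw [e1, e2]
  refine ⟨by gcongr; exact rpow_one_add_le_one_add_mul_self hts hm0.le hm1.le, fun h => ?_⟩
  by_contra hne
  have h3 : t / s - 1 ≠ 0 := by
    rw [sub_ne_zero, Ne, div_eq_one_iff_eq hs.ne']; exact hne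
  exact (rpow_one_add_lt_one_add_mul_self hts h3 hm0 hm1).ne (mul_left_cancel₀ hsm.ne' h)

theorem steadyState_eq_ofReal (hm0 : 0 < m) (hm1 : m < 1) {x : EuclideanSpace ℝ (Fin n)}
    (hx : 0 < V x + h) : ∃ s : ℝ, 0 < s ∧ steadyState m V h x = ENNReal.ofReal s ∧
      m * s ^ (m - 1) = (1 - m) * (V x + h) := by
  have ht := ofReal_ratio_pos hm0 hm1 hx
  have hd : 1 - m ≠ 0 := by linarith
  refine ⟨((1 - m) / m * (V x + h)) ^ (-(1 / (1 - m))), by positivity,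
    ENNReal.ofReal_rpow_of_pos ht, ?_⟩
  have e : -(1 / (1 - m)) * (m - 1) = 1 := by
    rw [← neg_sub 1 m]; field_simp
  rw [← Real.rpow_mul ht.le, e, Real.rpow_one]
  field_simp

theorem rpow_le_young (hm0 : 0 < m) (hm1 : m < 1) {x : EuclideanSpace ℝ (Fin n)}
    (hx : 0 ≤ V x + h) (u : ℝ≥0∞) :
    u ^ m ≤ ENNReal.ofReal (1 - m) *
      (ENNReal.ofReal (V x + h) * u + steadyState m V h x ^ m) := by
  have hd : 0 < 1 - m := by linarith
  have hd' : ENNReal.ofReal (1 - m) ≠ 0 := by simpa using hm1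
  rcases hx.eq_or_lt with hx | hx
  · rw [steadyState_eq_top hm1 hx.symm, ENNReal.top_rpow_of_pos hm0, add_top,
      ENNReal.mul_top hd']
    exact le_top
  by_cases hu : u = ∞
  · rw [hu, ENNReal.mul_top (by simpa using hx), top_add, ENNReal.mul_top hd']
    exact le_top
  obtain ⟨s, hs, hse, hsm⟩ := steadyState_eq_ofReal hm0 hm1 hx
  obtain ⟨t, ht, rfl⟩ : ∃ t : ℝ, 0 ≤ t ∧ u = ENNReal.ofReal t :=
    ⟨u.toReal, ENNReal.toReal_nonneg, (ENNReal.ofReal_toReal hu).symm⟩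
  rw [hse, ENNReal.ofReal_rpow_of_nonneg ht hm0.le, ENNReal.ofReal_rpow_of_nonneg hs.le hm0.le,
    ← ENNReal.ofReal_mul hx.le, ← ENNReal.ofReal_add (by positivity) (by positivity),
    ← ENNReal.ofReal_mul hd.le]
  refine ENNReal.ofReal_le_ofReal ?_
  have := (bernoulli_young hm0 hm1 hs ht).1
  rw [hsm] at this
  linarith

theorem eq_steadyState_of_young_eq (hm0 : 0 < m) (hm1 : m < 1) {x : EuclideanSpace ℝ (Fin n)}
    (hx : 0 < V x + h) {u : ℝ≥0∞} (hu : u ≠ ∞)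
    (heq : u ^ m = ENNReal.ofReal (1 - m) *
      (ENNReal.ofReal (V x + h) * u + steadyState m V h x ^ m)) :
    u = steadyState m V h x := by
  have hd : 0 < 1 - m := by linarith
  obtain ⟨s, hs, hse, hsm⟩ := steadyState_eq_ofReal hm0 hm1 hx
  obtain ⟨t, ht, rfl⟩ : ∃ t : ℝ, 0 ≤ t ∧ u = ENNReal.ofReal t :=
    ⟨u.toReal, ENNReal.toReal_nonneg, (ENNReal.ofReal_toReal hu).symm⟩
  rw [hse, ENNReal.ofReal_rpow_of_nonneg ht hm0.le, ENNReal.ofReal_rpow_of_nonneg hs.le hm0.le,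
    ← ENNReal.ofReal_mul hx.le, ← ENNReal.ofReal_add (by positivity) (by positivity),
    ← ENNReal.ofReal_mul hd.le, ENNReal.ofReal_eq_ofReal_iff (by positivity) (by positivity)] at heq
  rw [hse, (bernoulli_young hm0 hm1 hs ht).2]
  rw [hsm]
  linarith

/-- The steady state is infinite where V + h vanishes, so finite mass makes that set null. -/
theorem ae_pos_of_lintegral_steadyState_ne_top (hm1 : m < 1) (hVc : Continuous V)
    (hV : ∀ x, 0 ≤ V x) (hh : 0 ≤ h) {μ : Measure (EuclideanSpace ℝ (Fin n))}
    (hA : ∫⁻ x, steadyState m V h x ∂μ ≠ ∞) : ∀ᵐ x ∂μ, 0 < V x + h := by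
  filter_upwards [ae_lt_top (measurable_steadyState m hVc h) hA] with x hx
  refine (add_nonneg (hV x) hh).lt_of_ne fun h0 => hx.ne ?_
  exact steadyState_eq_top hm1 h0.symm

theorem lintegral_steadyState_rpow (hm0 : 0 < m) (hm1 : m < 1) (hVc : Continuous V)
    (hV : ∀ x, 0 ≤ V x) (hh : 0 ≤ h) {μ : Measure (EuclideanSpace ℝ (Fin n))}
    (hA : ∫⁻ x, steadyState m V h x ∂μ ≠ ∞) :
    ∫⁻ x, steadyState m V h x ^ m ∂μ = ENNReal.ofReal ((1 - m) / m) *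
      ((∫⁻ x, ENNReal.ofReal (V x) * steadyState m V h x ∂μ) +
        ENNReal.ofReal h * ∫⁻ x, steadyState m V h x ∂μ) := by
  have hs := measurable_steadyState m hVc h
  rw [← lintegral_const_mul _ hs, ← lintegral_add_right _ (hs.const_mul _),
    ← lintegral_const_mul' _ _ ENNReal.ofReal_ne_top]
  refine lintegral_congr_ae ?_
  filter_upwards [ae_pos_of_lintegral_steadyState_ne_top hm1 hVc hV hh hA] with x hx
  rw [steadyState_rpow hm0 hm1 hx, ENNReal.ofReal_add (hV x) hh, add_mul]

/-! ### Integrability of the steady states -/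

theorem setLIntegral_ball_potential_ne_top (hVc : Continuous V)
    {f : EuclideanSpace ℝ (Fin n) → ℝ≥0∞} {R : ℝ}
    (hf : ∫⁻ x in Metric.ball 0 R, f x ≠ ∞) :
    ∫⁻ x in Metric.ball 0 R, ENNReal.ofReal (V x) * f x ≠ ∞ := by
  obtain ⟨M, hM⟩ := (isCompact_closedBall (0 : EuclideanSpace ℝ (Fin n)) R).exists_bound_of_continuousOn
    hVc.continuousOn
  refine ne_top_of_le_ne_top (b := ENNReal.ofReal M * ∫⁻ x in Metric.ball 0 R, f x)
    (by finiteness) ?_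
  rw [← lintegral_const_mul' _ _ ENNReal.ofReal_ne_top]
  refine setLIntegral_mono' measurableSet_ball fun x hx => ?_
  gcongr
  exact (le_abs_self _).trans (hM x (Metric.ball_subset_closedBall hx))

/-- Testing the lower bound of the energy with truncated and scaled steady states. -/
theorem truncated_steadyState_bound (hm0 : 0 < m) (hm1 : m < 1) (hVc : Continuous V)
    (hV : ∀ x, 0 ≤ V x) (hV0 : V 0 = 0) (hh : 0 ≤ h) {K : NNReal}
    (hK : ∀ ρ : EuclideanSpace ℝ (Fin n) → ℝ, IsProbDensity ρ →
      powerIntegral m ρ ≤ ENNReal.ofReal (1 - m) * (potentialIntegral V ρ + K))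
    {θ R : ℝ} (hθ : 0 < θ) (hθ1 : θ ≤ 1)
    (hA : ∫⁻ x in Metric.ball 0 R, steadyState m V h x ≠ ∞)
    (hθA : ENNReal.ofReal θ * ∫⁻ x in Metric.ball 0 R, steadyState m V h x ≤ 1) :
    θ ^ m * ((1 - m) *
        (∫⁻ x in Metric.ball 0 R, ENNReal.ofReal (V x) * steadyState m V h x).toReal +
      h * (∫⁻ x in Metric.ball 0 R, steadyState m V h x).toReal) ≤ m * (1 + K) := by
  have hd : 0 < 1 - m := by linarith
  have hs := measurable_steadyState m hVc h
  have hP := setLIntegral_ball_potential_ne_top hVc hA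
  have hI := lintegral_steadyState_rpow hm0 hm1 hVc hV hh hA
  have hB : MeasurableSet (Metric.ball (0 : EuclideanSpace ℝ (Fin n)) R) := measurableSet_ball
  obtain ⟨f, hf⟩ : ∃ f : EuclideanSpace ℝ (Fin n) → ℝ≥0∞,
      f = (Metric.ball 0 R).indicator fun x => ENNReal.ofReal θ * steadyState m V h x := ⟨_, rfl⟩
  have hfm : Measurable f := hf ▸ (hs.const_mul _).indicator hB
  have hf1 : ∫⁻ x, f x ≤ 1 := by
    rw [hf, lintegral_indicator hB, lintegral_const_mul _ hs]
    exact hθA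
  have hfI : ∫⁻ x, f x ^ m =
      ENNReal.ofReal (θ ^ m) * ∫⁻ x in Metric.ball 0 R, steadyState m V h x ^ m := by
    rw [← lintegral_const_mul _ (hs.pow_const _), ← lintegral_indicator hB]
    congr 1 with x
    rw [hf]
    by_cases hx : x ∈ Metric.ball (0 : EuclideanSpace ℝ (Fin n)) R
    · simp only [hx, Set.indicator_of_mem]
      rw [ENNReal.mul_rpow_of_nonneg _ _ hm0.le, ENNReal.ofReal_rpow_of_pos hθ]
    · simp only [hx, Set.indicator_of_notMem, not_false_eq_true]
      exact ENNReal.zero_rpow_of_pos hm0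
  have hfP : ∫⁻ x, ENNReal.ofReal (V x) * f x = ENNReal.ofReal θ *
      ∫⁻ x in Metric.ball 0 R, ENNReal.ofReal (V x) * steadyState m V h x := by
    rw [← lintegral_const_mul' _ _ ENNReal.ofReal_ne_top, ← lintegral_indicator hB]
    congr 1 with x
    rw [hf]
    by_cases hx : x ∈ Metric.ball (0 : EuclideanSpace ℝ (Fin n)) R
    · simp only [hx, Set.indicator_of_mem]
      ring
    · simp [hx]
  -- Completing the mass costs at most 1 in potential energy, whence 1 + K in the bound.
  obtain ⟨ρ, hρ, hρI, hρP⟩ := exists_isProbDensity_completion hm0 hVc hV hV0 hfm hf1 one_pos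
  have key := hρI.trans (hK ρ hρ)
  have key2 : ∫⁻ x, f x ^ m ≤ ENNReal.ofReal (1 - m) *
      ((∫⁻ x, ENNReal.ofReal (V x) * f x) + ENNReal.ofReal 1 + K) := by
    refine key.trans ?_
    gcongr
  rw [hfI, hfP, hI] at key2
  generalize (∫⁻ x in Metric.ball 0 R, ENNReal.ofReal (V x) * steadyState m V h x) = P at *
  generalize (∫⁻ x in Metric.ball 0 R, steadyState m V h x) = A at *
  lift P to NNReal using hP
  lift A to NNReal using hA
  have key3 := ENNReal.toReal_mono (by finiteness) key2
  rw [ENNReal.toReal_mul, ENNReal.toReal_mul, ENNReal.toReal_mul,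
    ENNReal.toReal_add (by finiteness) (by finiteness),
    ENNReal.toReal_add (by finiteness) (by finiteness),
    ENNReal.toReal_add (by finiteness) (by finiteness), ENNReal.toReal_mul, ENNReal.toReal_mul,
    ENNReal.toReal_ofReal (by positivity), ENNReal.toReal_ofReal (by positivity),
    ENNReal.toReal_ofReal (by positivity), ENNReal.toReal_ofReal (by positivity),
    ENNReal.toReal_ofReal (by positivity), ENNReal.toReal_ofReal (by positivity)] at key3
  simp only [ENNReal.coe_toReal] at key3 ⊢
  -- The power term scales like θ^m and the potential like θ. As θ ≤ θ^m, the potential can be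
  -- absorbed after the Euler–Lagrange relation is inserted, leaving the factor 1 - m.
  have hθm : θ ≤ θ ^ m := by
    conv_lhs => rw [← Real.rpow_one θ]
    exact Real.rpow_le_rpow_of_exponent_ge hθ hθ1 hm1.le
  have hP0 : (0 : ℝ) ≤ P := P.2
  have e1 : θ ^ m * ((1 - m) / m * (P + h * A)) = (1 - m) * ((θ ^ m * (P + h * A)) / m) := by
    field_simp
  rw [e1, mul_le_mul_iff_right₀ hd, div_le_iff₀ hm0] at key3
  have e2 : m * (θ * P) ≤ m * (θ ^ m * P) := by gcongr
  linarith

theorem lintegral_le_of_forall_ball {f : EuclideanSpace ℝ (Fin n) → ℝ≥0∞} {c : ℝ≥0∞}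
    (hc : ∀ R : ℝ, ∫⁻ x in Metric.ball 0 R, f x ≤ c) : ∫⁻ x, f x ≤ c := by
  have hmono : Directed (· ⊆ ·) fun k : ℕ => Metric.ball (0 : EuclideanSpace ℝ (Fin n)) k :=
    Monotone.directed_le fun _ _ hij => Metric.ball_subset_ball (by exact_mod_cast hij)
  have := setLIntegral_iUnion_of_directed (μ := volume) f hmono
  rw [Metric.iUnion_ball_nat, setLIntegral_univ] at this
  rw [this]
  exact iSup_le fun k => hc k

/-- The truncations already have mass at most 1, so θ = 1 is allowed and the bound does not depend
on R. -/
theorem lintegral_potential_steadyState_ne_top (hm0 : 0 < m) (hm1 : m < 1) (hVc : Continuous V)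
    (hV : ∀ x, 0 ≤ V x) (hV0 : V 0 = 0) (hh : 0 ≤ h) {K : NNReal}
    (hK : ∀ ρ : EuclideanSpace ℝ (Fin n) → ℝ, IsProbDensity ρ →
      powerIntegral m ρ ≤ ENNReal.ofReal (1 - m) * (potentialIntegral V ρ + K))
    (ha : steadyMass m V h ≤ 1) :
    ∫⁻ x, ENNReal.ofReal (V x) * steadyState m V h x ≠ ∞ := by
  have hd : 0 < 1 - m := by linarith
  refine ne_top_of_le_ne_top (b := ENNReal.ofReal (m * (1 + K) / (1 - m))) (by finiteness) ?_
  refine lintegral_le_of_forall_ball fun R => ?_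
  have hA1 : ∫⁻ x in Metric.ball 0 R, steadyState m V h x ≤ 1 :=
    (setLIntegral_le_lintegral _ _).trans ha
  have hA := ne_top_of_le_ne_top ENNReal.one_ne_top hA1
  have := truncated_steadyState_bound hm0 hm1 hVc hV hV0 hh hK one_pos le_rfl hA (by simpa)
  rw [Real.one_rpow, one_mul] at this
  rw [ENNReal.le_ofReal_iff_toReal_le (setLIntegral_ball_potential_ne_top hVc hA) (by positivity),
    le_div_iff₀ hd]
  have h2 : 0 ≤ h * (∫⁻ x in Metric.ball 0 R, steadyState m V h x).toReal := by positivity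
  linarith

theorem setLIntegral_ball_steadyState_ne_top (hm0 : 0 < m) (hm1 : m < 1)
    (hV : ∀ x, 0 ≤ V x) (hh : 0 < h) (R : ℝ) :
    ∫⁻ x in Metric.ball 0 R, steadyState m V h x ≠ ∞ := by
  have hb : ∀ x, steadyState m V h x ≤ ENNReal.ofReal ((1 - m) / m * h) ^ (-(1 / (1 - m))) := by
    intro x
    have : 0 < 1 - m := by linarith
    rw [steadyState, ENNReal.rpow_neg, ENNReal.rpow_neg]
    gcongr
    linarith [hV x]
  refine ne_top_of_le_ne_top ?_ (lintegral_mono fun x => hb x)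
  rw [lintegral_const, Measure.restrict_apply_univ]
  refine ENNReal.mul_ne_top (ENNReal.rpow_ne_top_of_ne_zero ?_ (by simp)) measure_ball_lt_top.ne
  simpa using ofReal_ratio_pos hm0 hm1 hh

theorem steadyMass_ne_top (hm0 : 0 < m) (hm1 : m < 1) (hVc : Continuous V)
    (hV : ∀ x, 0 ≤ V x) (hV0 : V 0 = 0) (hh : 0 < h) {K : NNReal}
    (hK : ∀ ρ : EuclideanSpace ℝ (Fin n) → ℝ, IsProbDensity ρ →
      powerIntegral m ρ ≤ ENNReal.ofReal (1 - m) * (potentialIntegral V ρ + K)) :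
    steadyMass m V h ≠ ∞ := by
  have hd : 0 < 1 - m := by linarith
  refine ne_top_of_le_ne_top (b := ENNReal.ofReal (max 1 ((m * (1 + K) / h) ^ (1 / (1 - m)))))
    (by finiteness) ?_
  refine lintegral_le_of_forall_ball fun R => ?_
  have hA := setLIntegral_ball_steadyState_ne_top hm0 hm1 hV hh R
  have hb := fun θ h1 h2 h3 =>
    truncated_steadyState_bound (θ := θ) hm0 hm1 hVc hV hV0 hh.le hK h1 h2 hA h3
  have hP0 : 0 ≤ (∫⁻ x in Metric.ball 0 R,
    ENNReal.ofReal (V x) * steadyState m V h x).toReal := ENNReal.toReal_nonneg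
  rw [ENNReal.le_ofReal_iff_toReal_le hA (by positivity)]
  generalize (∫⁻ x in Metric.ball 0 R, ENNReal.ofReal (V x) * steadyState m V h x).toReal = P at *
  generalize (∫⁻ x in Metric.ball 0 R, steadyState m V h x) = A at *
  lift A to NNReal using hA
  simp only [ENNReal.coe_toReal] at hb ⊢
  rcases le_total (A : ℝ) 1 with h1 | h1
  · exact h1.trans (le_max_left _ _)
  refine le_max_of_le_right ?_
  have hA0 : (0 : ℝ) < A := by linarith
  -- Normalising the truncation to mass one turns the bound into h A^(1-m) ≤ m(1+K), uniformly in R.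
  have h2 := hb (A : ℝ)⁻¹ (by positivity) (inv_le_one_of_one_le₀ h1) (by
    rw [← ENNReal.ofReal_coe_nnreal, ← ENNReal.ofReal_mul (by positivity),
      inv_mul_cancel₀ hA0.ne', ENNReal.ofReal_one])
  have h3 : 0 ≤ (A : ℝ)⁻¹ ^ m * ((1 - m) * P) := by positivity
  have h4 : (A : ℝ)⁻¹ ^ m * (h * A) = h * (A : ℝ) ^ (1 - m) := by
    rw [Real.rpow_sub hA0, Real.rpow_one, Real.inv_rpow hA0.le]
    field_simp
  have h5 : (A : ℝ) ^ (1 - m) ≤ m * (1 + K) / h := by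
    rw [le_div_iff₀ hh]; linarith
  rw [one_div, Real.le_rpow_inv_iff_of_pos hA0.le (by positivity) hd]
  exact h5

/-! ### The mass as a function of h -/

theorem continuous_steadyState_shift (m : ℝ) (V : EuclideanSpace ℝ (Fin n) → ℝ)
    (x : EuclideanSpace ℝ (Fin n)) : Continuous fun h : ℝ => steadyState m V h x :=
  ENNReal.continuous_rpow_const.comp (ENNReal.continuous_ofReal.comp (by fun_prop))

theorem tendsto_steadyState_atTop (hm0 : 0 < m) (hm1 : m < 1) (x : EuclideanSpace ℝ (Fin n)) :
    Filter.Tendsto (fun h : ℝ => steadyState m V h x) Filter.atTop (nhds 0) := by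
  have hd : 0 < 1 - m := by linarith
  have h1 : Filter.Tendsto (fun h : ℝ => ENNReal.ofReal ((1 - m) / m * (V x + h)))
      Filter.atTop (nhds ∞) :=
    ENNReal.tendsto_ofReal_atTop.comp
      ((Filter.tendsto_atTop_add_const_left _ _ Filter.tendsto_id).const_mul_atTop (by positivity))
  have h2 := (ENNReal.continuous_rpow_const (y := -(1 / (1 - m)))).tendsto ∞
  rw [ENNReal.top_rpow_of_neg (by rw [neg_lt_zero]; positivity)] at h2
  exact h2.comp h1

/-- Either the mass one is attained by some `ρ_{V+h}`, or `ρ_V` has mass less than one. -/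
theorem exists_steadyMass_eq_one_or_lt (hm0 : 0 < m) (hm1 : m < 1) (hVc : Continuous V)
    (hfin : ∀ h : ℝ, 0 < h → steadyMass m V h ≠ ∞) :
    (∃ h : ℝ, 0 ≤ h ∧ steadyMass m V h = 1) ∨ steadyMass m V 0 < 1 := by
  rcases lt_trichotomy (steadyMass m V 0) 1 with h0 | h0 | h0
  · exact Or.inr h0
  · exact Or.inl ⟨0, le_rfl, h0⟩
  left
  have hmeas : ∀ h, Measurable (steadyState m V h) := fun h => measurable_steadyState m hVc h
  have hcont : ContinuousOn (steadyMass m V) (Set.Ioi 0) := by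
    intro h hh
    refine ContinuousAt.continuousWithinAt ?_
    have hh' : 0 < h := hh
    refine tendsto_lintegral_filter_of_dominated_convergence (steadyState m V (h / 2))
      (.of_forall hmeas) ?_ (hfin _ (by positivity))
      (.of_forall fun x => (continuous_steadyState_shift m V x).tendsto h)
    filter_upwards [Ioi_mem_nhds (half_lt_self hh')] with k hk
    exact .of_forall fun x => steadyState_antitone hm0 hm1 x (le_of_lt hk)
  have hlim : Filter.Tendsto (steadyMass m V) Filter.atTop (nhds 0) := by
    have := tendsto_lintegral_filter_of_dominated_convergence (μ := volume)
      (l := (Filter.atTop : Filter ℝ)) (F := fun h => steadyState m V h) (f := fun _ => 0)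
      (steadyState m V 1) (.of_forall hmeas) ?_ (hfin _ one_pos)
      (.of_forall fun x => tendsto_steadyState_atTop hm0 hm1 x)
    · rwa [lintegral_zero] at this
    · filter_upwards [Filter.eventually_ge_atTop 1] with k hk
      exact .of_forall fun x => steadyState_antitone hm0 hm1 x hk
  -- The mass at h = 0 may be infinite, so domination is not available there; monotone convergence
  -- along 1/(k+1) still yields some h > 0 with mass above 1.
  have hlim0 : Filter.Tendsto (fun k : ℕ => steadyMass m V (1 / ((k : ℝ) + 1))) Filter.atTop
      (nhds (steadyMass m V 0)) := by
    refine lintegral_tendsto_of_tendsto_of_monotone (fun k => (hmeas _).aemeasurable)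
      (.of_forall fun x => ?_) (.of_forall fun x => ?_)
    · intro i j hij
      exact steadyState_antitone hm0 hm1 x (Nat.one_div_le_one_div hij)
    · exact ((continuous_steadyState_shift m V x).tendsto 0).comp
        tendsto_one_div_add_atTop_nhds_zero_nat
  obtain ⟨k, hk⟩ := (hlim0.eventually_const_lt h0).exists
  obtain ⟨h₂, hh₂, hh₂'⟩ := ((hlim.eventually_lt_const one_pos).and
    (Filter.eventually_ge_atTop (1 / ((k : ℝ) + 1)))).exists
  have hk0 : 0 < 1 / ((k : ℝ) + 1) := by positivity
  obtain ⟨h, hh, hh1⟩ := intermediate_value_Icc' hh₂'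
    (hcont.mono fun y hy => hk0.trans_le hy.1) ⟨hh₂.le, hk.le⟩
  exact ⟨h, hk0.le.trans hh.1, hh1⟩

/-! ### Lower bound for the energies and its equality case -/

theorem lintegral_rpow_le_young (hm0 : 0 < m) (hm1 : m < 1) (hVc : Continuous V)
    (hV : ∀ x, 0 ≤ V x) (hh : 0 ≤ h) (u : EuclideanSpace ℝ (Fin n) → ℝ≥0∞) :
    ∫⁻ x, u x ^ m ≤ ENNReal.ofReal (1 - m) * ((∫⁻ x, ENNReal.ofReal (V x + h) * u x) +
      ∫⁻ x, steadyState m V h x ^ m) := by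
  rw [← lintegral_add_right _ ((measurable_steadyState m hVc h).pow_const m),
    ← lintegral_const_mul' _ _ ENNReal.ofReal_ne_top]
  exact lintegral_mono fun x => rpow_le_young hm0 hm1 (add_nonneg (hV x) hh) (u x)

theorem neg_le_freeEnergy (hm0 : 0 < m) (hm1 : m < 1) (hVc : Continuous V)
    (hV : ∀ x, 0 ≤ V x) (hh : 0 ≤ h) {D : NNReal}
    (hD : (D : ℝ≥0∞) = ENNReal.ofReal h + ∫⁻ x, steadyState m V h x ^ m)
    {ρ : EuclideanSpace ℝ (Fin n) → ℝ} (hρ : IsProbDensity ρ) :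
    ((-(D : ℝ) : ℝ) : EReal) ≤ freeEnergy m V ρ := by
  rw [freeEnergy, scaledFreeEnergy, neg_le_energyValue_iff hm1, hD, ← add_assoc]
  have hI : powerIntegral m ρ = ∫⁻ x, ENNReal.ofReal (ρ x) ^ m :=
    lintegral_congr fun x => (ENNReal.ofReal_rpow_of_nonneg (hρ.nonneg x) hm0.le).symm
  have h1 : ∫⁻ x, ENNReal.ofReal (ρ x) = 1 := by
    rw [← ofReal_integral_eq_lintegral_ofReal hρ.integrable (.of_forall hρ.nonneg), hρ.mass_one,
      ENNReal.ofReal_one]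
  have hP : potentialIntegral V ρ + ENNReal.ofReal h =
      ∫⁻ x, ENNReal.ofReal (V x + h) * ENNReal.ofReal (ρ x) := by
    conv_lhs => rw [← mul_one (ENNReal.ofReal h), ← h1]
    rw [← lintegral_const_mul' _ _ ENNReal.ofReal_ne_top, potentialIntegral,
      ← lintegral_add_right' _ (hρ.integrable.aemeasurable.ennreal_ofReal.const_mul _)]
    refine lintegral_congr fun x => ?_
    rw [ENNReal.ofReal_mul (hV x), ENNReal.ofReal_add (hV x) hh, add_mul]
  rw [hI, hP]
  exact lintegral_rpow_le_young hm0 hm1 hVc hV hh _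

theorem lintegral_potential_decomposition (hVc : Continuous V) (hV : ∀ x, 0 ≤ V x) (hh : 0 ≤ h)
    (ν : Measure (EuclideanSpace ℝ (Fin n))) [IsProbabilityMeasure ν] :
    (∫⁻ x, ENNReal.ofReal (V x) ∂ν) + ENNReal.ofReal h =
      (∫⁻ x, ENNReal.ofReal (V x + h) ∂ν.singularPart volume) +
        ∫⁻ x, ENNReal.ofReal (V x + h) * ν.rnDeriv volume x := by
  have hm : Measurable fun x => ENNReal.ofReal (V x + h) :=
    (hVc.measurable.add_const h).ennreal_ofReal
  have h1 : (∫⁻ x, ENNReal.ofReal (V x) ∂ν) + ENNReal.ofReal h =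
      ∫⁻ x, ENNReal.ofReal (V x + h) ∂ν := by
    have : ∫⁻ _, ENNReal.ofReal h ∂ν = ENNReal.ofReal h := by simp
    conv_lhs => rw [← this]
    rw [← lintegral_add_right _ measurable_const]
    exact lintegral_congr fun x => (ENNReal.ofReal_add (hV x) hh).symm
  rw [h1]
  conv_lhs => rw [ν.haveLebesgueDecomposition_add volume]
  rw [lintegral_add_measure,
    lintegral_withDensity_eq_lintegral_mul _ (Measure.measurable_rnDeriv _ _) hm]
  congr 1
  exact lintegral_congr fun x => mul_comm _ _

theorem neg_le_relaxedFreeEnergy (hm0 : 0 < m) (hm1 : m < 1) (hVc : Continuous V)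
    (hV : ∀ x, 0 ≤ V x) (hh : 0 ≤ h) {D : NNReal}
    (hD : (D : ℝ≥0∞) = ENNReal.ofReal h + ∫⁻ x, steadyState m V h x ^ m)
    (ν : Measure (EuclideanSpace ℝ (Fin n))) [IsProbabilityMeasure ν] :
    ((-(D : ℝ) : ℝ) : EReal) ≤ relaxedFreeEnergy m V ν := by
  rw [relaxedFreeEnergy, neg_le_energyValue_iff hm1, hD, ← add_assoc,
    lintegral_potential_decomposition hVc hV hh]
  refine (lintegral_rpow_le_young hm0 hm1 hVc hV hh _).trans ?_
  gcongr
  exact le_add_self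

theorem rnDeriv_eq_of_relaxedFreeEnergy_eq (hm0 : 0 < m) (hm1 : m < 1) (hVc : Continuous V)
    (hV : ∀ x, 0 ≤ V x) (hh : 0 ≤ h) (ha : steadyMass m V h ≠ ∞) {D : NNReal}
    (hD : (D : ℝ≥0∞) = ENNReal.ofReal h + ∫⁻ x, steadyState m V h x ^ m)
    (ν : Measure (EuclideanSpace ℝ (Fin n))) [IsProbabilityMeasure ν]
    (hν : relaxedFreeEnergy m V ν = ((-(D : ℝ) : ℝ) : EReal)) :
    ν.rnDeriv volume =ᵐ[volume] steadyState m V h ∧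
      ∫⁻ x, ENNReal.ofReal (V x + h) ∂ν.singularPart volume = 0 := by
  rw [relaxedFreeEnergy, energyValue_eq_neg_iff hm1] at hν
  obtain ⟨hP, hI⟩ := hν
  have hd : ENNReal.ofReal (1 - m) ≠ 0 := by simpa using hm1
  have hJ : ∫⁻ x, steadyState m V h x ^ m ≠ ∞ :=
    ne_top_of_le_ne_top (hD ▸ ENNReal.coe_ne_top) le_add_self
  have hdec := lintegral_potential_decomposition hVc hV hh ν
  have hYX := ENNReal.add_ne_top.mp (hdec ▸ ENNReal.add_ne_top.mpr ⟨hP, ENNReal.ofReal_ne_top⟩)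
  have hY : ∫⁻ x, ENNReal.ofReal (V x + h) ∂ν.singularPart volume ≠ ∞ := hYX.1
  have hX : ∫⁻ x, ENNReal.ofReal (V x + h) * ν.rnDeriv volume x ≠ ∞ := hYX.2
  rw [hD, ← add_assoc, hdec] at hI
  have hle := lintegral_rpow_le_young hm0 hm1 hVc hV hh (ν.rnDeriv volume)
  -- Equality of energies puts the singular term Y on the smaller side of the integrated tangent
  -- inequality; cancelling the finite X + J leaves Y ≤ 0.
  have hY0 : ∫⁻ x, ENNReal.ofReal (V x + h) ∂ν.singularPart volume = 0 := by
    rw [hI, ENNReal.mul_le_mul_iff_right hd ENNReal.ofReal_ne_top, add_assoc] at hle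
    generalize (∫⁻ x, ENNReal.ofReal (V x + h) ∂ν.singularPart volume) = Y at *
    have hXJ := ENNReal.add_ne_top.mpr ⟨hX, hJ⟩
    exact nonpos_iff_eq_zero.mp (ENNReal.le_of_add_le_add_right hXJ (by rwa [zero_add]))
  refine ⟨?_, hY0⟩
  rw [hY0, zero_add] at hI
  have hs := measurable_steadyState m hVc h
  have hu := Measure.measurable_rnDeriv ν volume
  have hm : Measurable fun x => ENNReal.ofReal (V x + h) :=
    (hVc.measurable.add_const h).ennreal_ofReal
  have hI' : ∫⁻ x, ν.rnDeriv volume x ^ m = ∫⁻ x, ENNReal.ofReal (1 - m) *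
      (ENNReal.ofReal (V x + h) * ν.rnDeriv volume x + steadyState m V h x ^ m) := by
    rw [hI, lintegral_const_mul' _ _ ENNReal.ofReal_ne_top,
      lintegral_add_right _ (hs.pow_const m)]
  -- A pointwise inequality between functions with the same finite integral is an equality almost
  -- everywhere.
  have hae := ae_eq_of_ae_le_of_lintegral_le
    (.of_forall fun x => rpow_le_young hm0 hm1 (add_nonneg (hV x) hh) (ν.rnDeriv volume x))
    (by rw [hI]; finiteness) (((hm.mul hu).add (hs.pow_const m)).const_mul _).aemeasurable hI'.ge
  filter_upwards [hae, ae_pos_of_lintegral_steadyState_ne_top hm1 hVc hV hh ha,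
    Measure.rnDeriv_lt_top ν volume] with x hx1 hx2 hx3
  exact eq_steadyState_of_young_eq hm0 hm1 hx2 hx3.ne hx1

/-! ### Identification of the minimiser -/

/-- A zero x ≠ 0 would make V vanish on the ball of radius ‖x‖, where the steady state would be
infinite. -/
theorem eq_zero_of_potential_eq_zero (hm1 : m < 1) (hVc : Continuous V)
    (hV : ∀ x, 0 ≤ V x) (hrad : ∀ x y : EuclideanSpace ℝ (Fin n), ‖x‖ ≤ ‖y‖ → V x ≤ V y)
    (ha : steadyMass m V 0 ≠ ∞) {x : EuclideanSpace ℝ (Fin n)} (hx : V x = 0) : x = 0 := by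
  by_contra hne
  have hpos := Metric.measure_ball_pos volume (0 : EuclideanSpace ℝ (Fin n)) (norm_pos_iff.mpr hne)
  refine hpos.ne' (measure_mono_null (fun y hy => ?_)
    (ae_iff.mp (ae_pos_of_lintegral_steadyState_ne_top hm1 hVc hV le_rfl ha)))
  have : V y ≤ V x := hrad _ _ (by simpa using (mem_ball_zero_iff.mp hy).le)
  change ¬ 0 < V y + 0
  linarith

theorem eq_of_relaxedFreeEnergy_eq (hm0 : 0 < m) (hm1 : m < 1) (hVc : Continuous V)
    (hV : ∀ x, 0 ≤ V x) (hrad : ∀ x y : EuclideanSpace ℝ (Fin n), ‖x‖ ≤ ‖y‖ → V x ≤ V y)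
    (hh : 0 ≤ h) (ha : steadyMass m V h ≤ 1) (hcase : h = 0 ∨ steadyMass m V h = 1) {D : NNReal}
    (hD : (D : ℝ≥0∞) = ENNReal.ofReal h + ∫⁻ x, steadyState m V h x ^ m)
    (ν : Measure (EuclideanSpace ℝ (Fin n))) [IsProbabilityMeasure ν]
    (hν : relaxedFreeEnergy m V ν = ((-(D : ℝ) : ℝ) : EReal)) :
    ν = (1 - steadyMass m V h) • Measure.dirac 0 + volume.withDensity (steadyState m V h) := by
  have hat := ne_top_of_le_ne_top ENNReal.one_ne_top ha
  obtain ⟨hu, hY⟩ := rnDeriv_eq_of_relaxedFreeEnergy_eq hm0 hm1 hVc hV hh hat hD ν hν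
  have hdec := ν.haveLebesgueDecomposition_add volume
  rw [withDensity_congr_ae hu] at hdec
  have hmass : ν.singularPart volume Set.univ = 1 - steadyMass m V h := by
    have h1 : ν Set.univ = 1 := measure_univ
    rw [hdec, Measure.add_apply, withDensity_apply _ MeasurableSet.univ, setLIntegral_univ] at h1
    exact ENNReal.eq_sub_of_add_eq hat h1
  have hsing : ν.singularPart volume = (1 - steadyMass m V h) • Measure.dirac 0 := by
    -- If h = 0, the singular part lives on the zero set {0} of V, and its total mass fixes the
    -- atom. If the steady state has mass one, nothing is left for it.
    rcases hcase with rfl | h1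
    · rw [lintegral_eq_zero_iff (hVc.measurable.add_const _).ennreal_ofReal] at hY
      have hae : ∀ᵐ x ∂ν.singularPart volume, x ∈ ({0} : Set (EuclideanSpace ℝ (Fin n))) := by
        filter_upwards [hY] with x hx
        refine eq_zero_of_potential_eq_zero hm1 hVc hV hrad hat ((hV x).antisymm' ?_)
        simpa using hx
      have h2 := Measure.restrict_eq_self_of_ae_mem hae
      rw [Measure.restrict_singleton] at h2
      rw [← h2, Measure.smul_apply] at hmass
      rw [← h2, ← hmass]
      simp
    · rw [h1, tsub_self] at hmass ⊢
      rw [zero_smul, Measure.measure_univ_eq_zero.mp hmass]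
  rw [hsing] at hdec
  exact hdec

/-! ### Attainment of the lower bound -/

theorem isProbabilityMeasure_stationary (ha : steadyMass m V h ≤ 1) :
    IsProbabilityMeasure ((1 - steadyMass m V h) • Measure.dirac 0 +
      volume.withDensity (steadyState m V h)) where
  measure_univ := by
    rw [Measure.add_apply, withDensity_apply _ MeasurableSet.univ, setLIntegral_univ,
      Measure.smul_apply, measure_univ, smul_eq_mul, mul_one]
    exact tsub_add_cancel_of_le ha

theorem energyValue_stationary (hm0 : 0 < m) (hm1 : m < 1) (hVc : Continuous V)
    (hV : ∀ x, 0 ≤ V x) (hh : 0 ≤ h) (ha : steadyMass m V h ≤ 1)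
    (hcase : h = 0 ∨ steadyMass m V h = 1) {D : NNReal}
    (hD : (D : ℝ≥0∞) = ENNReal.ofReal h + ∫⁻ x, steadyState m V h x ^ m)
    (hP : ∫⁻ x, ENNReal.ofReal (V x) * steadyState m V h x ≠ ∞) :
    energyValue m 1 (∫⁻ x, steadyState m V h x ^ m)
      (∫⁻ x, ENNReal.ofReal (V x) * steadyState m V h x) = ((-(D : ℝ) : ℝ) : EReal) := by
  have hd : 0 < 1 - m := by linarith
  have hat := ne_top_of_le_ne_top ENNReal.one_ne_top ha
  have hI := lintegral_steadyState_rpow hm0 hm1 hVc hV hh hat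
  have hha : ENNReal.ofReal h * ∫⁻ x, steadyState m V h x = ENNReal.ofReal h := by
    rcases hcase with rfl | h1
    · simp
    · rw [steadyMass] at h1
      rw [h1, mul_one]
  rw [hha] at hI
  have hJ : ∫⁻ x, steadyState m V h x ^ m ≠ ∞ := hI ▸ by finiteness
  rw [energyValue_of_ne_top hJ hP, EReal.coe_eq_coe_iff]
  have hD' := congrArg ENNReal.toReal hD
  have hI' := congrArg ENNReal.toReal hI
  rw [ENNReal.toReal_add (by finiteness) hJ, ENNReal.coe_toReal, ENNReal.toReal_ofReal hh] at hD'
  rw [ENNReal.toReal_mul, ENNReal.toReal_add hP (by finiteness), ENNReal.toReal_ofReal hh,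
    ENNReal.toReal_ofReal (by positivity)] at hI'
  rw [hD']
  generalize (∫⁻ x, steadyState m V h x ^ m).toReal = J at *
  generalize (∫⁻ x, ENNReal.ofReal (V x) * steadyState m V h x).toReal = P at *
  have hP' : P = m * J / (1 - m) - h := by
    rw [hI']; field_simp; ring
  have h1 : m - 1 ≠ 0 := by linarith
  rw [hP', ← neg_sub m 1]
  field_simp
  ring

theorem relaxedFreeEnergy_stationary (hn : 1 ≤ n) (hm0 : 0 < m) (hm1 : m < 1) (hVc : Continuous V)
    (hV : ∀ x, 0 ≤ V x) (hV0 : V 0 = 0) (hh : 0 ≤ h) (ha : steadyMass m V h ≤ 1)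
    (hcase : h = 0 ∨ steadyMass m V h = 1) {D : NNReal}
    (hD : (D : ℝ≥0∞) = ENNReal.ofReal h + ∫⁻ x, steadyState m V h x ^ m)
    (hP : ∫⁻ x, ENNReal.ofReal (V x) * steadyState m V h x ≠ ∞) :
    relaxedFreeEnergy m V ((1 - steadyMass m V h) • Measure.dirac 0 +
      volume.withDensity (steadyState m V h)) = ((-(D : ℝ) : ℝ) : EReal) := by
  -- Positive dimension makes points Lebesgue-null, so that δ_0 is singular.
  have : Nonempty (Fin n) := ⟨⟨0, hn⟩⟩
  have hs := measurable_steadyState m hVc h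
  have hVm : Measurable fun x => ENNReal.ofReal (V x) := hVc.measurable.ennreal_ofReal
  obtain ⟨μ, hμ⟩ : ∃ μ, μ = (1 - steadyMass m V h) •
      Measure.dirac (0 : EuclideanSpace ℝ (Fin n)) + volume.withDensity (steadyState m V h) :=
    ⟨_, rfl⟩
  have hprob := isProbabilityMeasure_stationary ha
  have hsing : ((1 - steadyMass m V h) • Measure.dirac (0 : EuclideanSpace ℝ (Fin n))) ⟂ₘ
      volume := by
    refine Measure.MutuallySingular.smul _ ⟨{0}ᶜ, (measurableSet_singleton 0).compl, ?_, ?_⟩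
    · simp
    · simp
  rw [← hμ] at hprob ⊢
  have hrn : steadyState m V h =ᵐ[volume] μ.rnDeriv volume := Measure.eq_rnDeriv hs hsing hμ
  rw [relaxedFreeEnergy, lintegral_congr_ae (hrn.symm.mono fun x hx => congrArg (· ^ m) hx), hμ,
    lintegral_add_measure, lintegral_smul_measure, lintegral_dirac' _ hVm, hV0,
    ENNReal.ofReal_zero, smul_zero, zero_add, lintegral_withDensity_eq_lintegral_mul _ hs hVm,
    ← energyValue_stationary hm0 hm1 hVc hV hh ha hcase hD hP]
  congr 1
  exact lintegral_congr fun x => mul_comm _ _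

theorem iInf_freeEnergy_le (hm0 : 0 < m) (hm1 : m < 1) (hVc : Continuous V)
    (hV : ∀ x, 0 ≤ V x) (hV0 : V 0 = 0) (hh : 0 ≤ h) (ha : steadyMass m V h ≤ 1)
    (hcase : h = 0 ∨ steadyMass m V h = 1) {D : NNReal}
    (hD : (D : ℝ≥0∞) = ENNReal.ofReal h + ∫⁻ x, steadyState m V h x ^ m)
    (hP : ∫⁻ x, ENNReal.ofReal (V x) * steadyState m V h x ≠ ∞) :
    (⨅ ρ : {ρ : EuclideanSpace ℝ (Fin n) → ℝ // IsProbDensity ρ}, freeEnergy m V ρ.1) ≤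
      ((-(D : ℝ) : ℝ) : EReal) := by
  refine EReal.le_of_forall_lt_iff_le.mp fun z hz => ?_
  rw [EReal.coe_lt_coe_iff] at hz
  -- The gap between z and -D is the potential energy allowed for spreading the atom.
  have hδ : 0 < z + D := by linarith
  obtain ⟨ρ, hρ, hρI, hρP⟩ := exists_isProbDensity_completion hm0 hVc hV hV0
    (measurable_steadyState m hVc h) ha hδ
  refine (iInf_le (fun ρ : {ρ : EuclideanSpace ℝ (Fin n) → ℝ // IsProbDensity ρ} =>
    freeEnergy m V ρ.1) ⟨ρ, hρ⟩).trans ((energyValue_mono hm1 hρI hρP).trans ?_)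
  have hE := energyValue_stationary hm0 hm1 hVc hV hh ha hcase hD hP
  have hJ : ∫⁻ x, steadyState m V h x ^ m ≠ ∞ :=
    ne_top_of_le_ne_top (hD ▸ ENNReal.coe_ne_top) le_add_self
  rw [energyValue_of_ne_top hJ hP, EReal.coe_eq_coe_iff] at hE
  rw [energyValue_of_ne_top hJ (by finiteness), EReal.coe_le_coe_iff,
    ENNReal.toReal_add hP (by finiteness), ENNReal.toReal_ofReal hδ.le]
  linarith

end

/-! ### The theorem -/

theorem mainTheorem5 {n : ℕ} (hn : 1 ≤ n) {m : ℝ} (hm0 : 0 < m) (hm1 : m < 1)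
    (V : EuclideanSpace ℝ (Fin n) → ℝ) (hVcont : Continuous V)
    (hVnonneg : ∀ x, 0 ≤ V x) (hV0 : V 0 = 0)
    (hbelow : ∃ ε : ℝ, 0 < ε ∧
      ⊥ < ⨅ ρ : {ρ : EuclideanSpace ℝ (Fin n) → ℝ // IsProbDensity ρ},
        scaledFreeEnergy m (1 - ε) V ρ.1) :
    -- control of both parts of the energy by the free energy
    (∃ C K : ℝ, 0 < C ∧ 0 < K ∧
      ∀ ρ : EuclideanSpace ℝ (Fin n) → ℝ, IsProbDensity ρ →
        ((powerIntegral m ρ + potentialIntegral V ρ : ℝ≥0∞) : EReal) ≤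
          (C : EReal) * ((K : EReal) + freeEnergy m V ρ)) ∧
    -- radially symmetric and non-decreasing potentials
    ((∀ x y, ‖x‖ ≤ ‖y‖ → V x ≤ V y) →
      -- existence of a minimiser of the relaxed energy
      (∃ μ : ProbabilityMeasure (EuclideanSpace ℝ (Fin n)),
        relaxedFreeEnergy m V μ =
          ⨅ ν : ProbabilityMeasure (EuclideanSpace ℝ (Fin n)), relaxedFreeEnergy m V ν) ∧
      -- the relaxation does not change the infimum
      (⨅ ν : ProbabilityMeasure (EuclideanSpace ℝ (Fin n)), relaxedFreeEnergy m V ν) =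
        (⨅ ρ : {ρ : EuclideanSpace ℝ (Fin n) → ℝ // IsProbDensity ρ}, freeEnergy m V ρ.1) ∧
      -- one of the two cases of the formula occurs
      ((∃ h : ℝ, 0 ≤ h ∧ steadyMass m V h = 1) ∨ steadyMass m V 0 < 1) ∧
      -- the formula for the minimiser
      ∀ μ : ProbabilityMeasure (EuclideanSpace ℝ (Fin n)),
        relaxedFreeEnergy m V μ =
            ⨅ ν : ProbabilityMeasure (EuclideanSpace ℝ (Fin n)), relaxedFreeEnergy m V ν →
          (∀ h : ℝ, 0 ≤ h → steadyMass m V h = 1 →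
            (μ : Measure (EuclideanSpace ℝ (Fin n))) =
              volume.withDensity (steadyState m V h)) ∧
          (steadyMass m V 0 < 1 →
            (μ : Measure (EuclideanSpace ℝ (Fin n))) =
              (1 - steadyMass m V 0) • Measure.dirac 0 +
                volume.withDensity (steadyState m V 0))) := by
  have hcontrol := exists_control_of_scaledFreeEnergy_bounded_below hm0 hm1 hbelow
  refine ⟨hcontrol, fun hrad => ?_⟩
  obtain ⟨K, hK⟩ := exists_powerIntegral_le hm1 hcontrol
  have hdich := exists_steadyMass_eq_one_or_lt hm0 hm1 hVcont fun h hh =>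
    steadyMass_ne_top hm0 hm1 hVcont hVnonneg hV0 hh hK
  -- Stated for every admissible h, so the formula holds for each such h without first proving h
  -- unique.
  have hmin : ∀ h : ℝ, 0 ≤ h → steadyMass m V h ≤ 1 → (h = 0 ∨ steadyMass m V h = 1) →
      (∃ μ : ProbabilityMeasure (EuclideanSpace ℝ (Fin n)),
        relaxedFreeEnergy m V μ =
          ⨅ ν : ProbabilityMeasure (EuclideanSpace ℝ (Fin n)), relaxedFreeEnergy m V ν) ∧
      (⨅ ν : ProbabilityMeasure (EuclideanSpace ℝ (Fin n)), relaxedFreeEnergy m V ν) =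
        (⨅ ρ : {ρ : EuclideanSpace ℝ (Fin n) → ℝ // IsProbDensity ρ}, freeEnergy m V ρ.1) ∧
      ∀ μ : ProbabilityMeasure (EuclideanSpace ℝ (Fin n)),
        relaxedFreeEnergy m V μ =
            ⨅ ν : ProbabilityMeasure (EuclideanSpace ℝ (Fin n)), relaxedFreeEnergy m V ν →
          (μ : Measure (EuclideanSpace ℝ (Fin n))) =
            (1 - steadyMass m V h) • Measure.dirac 0 + volume.withDensity (steadyState m V h) := by
    intro h hh ha hcase
    have hP := lintegral_potential_steadyState_ne_top hm0 hm1 hVcont hVnonneg hV0 hh hK ha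
    have hJ : ∫⁻ x, steadyState m V h x ^ m ≠ ∞ := by
      have hat : ∫⁻ x, steadyState m V h x ≠ ∞ := ne_top_of_le_ne_top ENNReal.one_ne_top ha
      rw [lintegral_steadyState_rpow hm0 hm1 hVcont hVnonneg hh hat]
      finiteness
    obtain ⟨D, hD⟩ : ∃ D : NNReal,
        (D : ℝ≥0∞) = ENNReal.ofReal h + ∫⁻ x, steadyState m V h x ^ m :=
      ⟨_, ENNReal.coe_toNNReal (by finiteness)⟩
    obtain ⟨μ₀, hμ₀⟩ : ∃ μ : ProbabilityMeasure (EuclideanSpace ℝ (Fin n)),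
        relaxedFreeEnergy m V μ = ((-(D : ℝ) : ℝ) : EReal) :=
      ⟨⟨_, isProbabilityMeasure_stationary ha⟩,
        relaxedFreeEnergy_stationary hn hm0 hm1 hVcont hVnonneg hV0 hh ha hcase hD hP⟩
    have hinf : (⨅ ν : ProbabilityMeasure (EuclideanSpace ℝ (Fin n)), relaxedFreeEnergy m V ν) =
        ((-(D : ℝ) : ℝ) : EReal) :=
      le_antisymm (hμ₀ ▸ iInf_le (fun ν : ProbabilityMeasure (EuclideanSpace ℝ (Fin n)) =>
          relaxedFreeEnergy m V ν) μ₀)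
        (le_iInf fun ν => neg_le_relaxedFreeEnergy hm0 hm1 hVcont hVnonneg hh hD ν)
    rw [hinf]
    refine ⟨⟨μ₀, hμ₀⟩, le_antisymm
      (le_iInf fun ρ => neg_le_freeEnergy hm0 hm1 hVcont hVnonneg hh hD ρ.2)
      (iInf_freeEnergy_le hm0 hm1 hVcont hVnonneg hV0 hh ha hcase hD hP), fun μ hμ => ?_⟩
    exact eq_of_relaxedFreeEnergy_eq hm0 hm1 hVcont hVnonneg hrad hh ha hcase hD μ hμ
  obtain ⟨h, hh, ha, hcase⟩ : ∃ h : ℝ, 0 ≤ h ∧ steadyMass m V h ≤ 1 ∧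
      (h = 0 ∨ steadyMass m V h = 1) := by
    rcases hdich with ⟨h, hh, h1⟩ | h1
    · exact ⟨h, hh, h1.le, Or.inr h1⟩
    · exact ⟨0, le_rfl, h1.le, Or.inl rfl⟩
  obtain ⟨hex, hinf, -⟩ := hmin h hh ha hcase
  refine ⟨hex, hinf, hdich, fun μ hμ => ⟨fun h' hh' h1 => ?_, fun h1 => ?_⟩⟩
  · have := (hmin h' hh' h1.le (Or.inr h1)).2.2 μ hμ
    rwa [h1, tsub_self, zero_smul, zero_add] at this
  · exact (hmin 0 le_rfl h1.le (Or.inl rfl)).2.2 μ hμ
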